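/- Let $N_n$ be the $n\times n$ matrix with entries $1$ in the positions $(i,i+1)$ for $1\le i<n$ and $0$ elsewhere, and let $J_n=I_n+N_n$. For integers $1\le r\le s$ and a prime $p$, let $\lambda_1\ge\cdots\ge\lambda_r>0$ be the sizes of the blocks in the Jordan canonical form $J_{\lambda_1}\oplus\cdots\oplus J_{\lambda_r}$ of $J_r\otimes J_s$ over a field of characteristic $p$ (they depend only on $r,s,p$), and let the Norman permutation $\pi(r,s,p)$ be the permutation of $\{1,\dots,r\}$ that sends $n$ to $(r+1-n)+s-\lambda_n$. For $1\le i\le j\le r$ let $\mathrm{Rev}(i,j)$ be the permutation that sends $n$ to $i+j-n$ for $i\le n\le j$ and fixes all other points. For $r'<r$, a permutation of $\{1,\dots,r'\}$ is regarded as a permutation of $\{1,\dots,r\}$ fixing $r'+1,\dots,r$. **Proposition.** Let $1\le r\le s$, let $p$ be a prime and let $m\ge 0$ be an integer with $r\le p^m$. Write $s_{\bmod p^m}$ for the remainder of $s$ on division by $p^m$. In each of the following cases the permutation $\pi(r,s,p)$ is well defined, independently of the field of characteristic $p$, and is given as follows. 0. If $s_{\bmod p^m}=0$, then $\pi(r,s,p)=\mathrm{Rev}(1,r)$.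 1. If $s_{\bmod p^m}=1$ and $r\ge 2$, then $\pi(r,s,p)=\mathrm{Rev}(2,r)$. 2. If $s_{\bmod p^m}=2$ and $r\ge 3$, then $\pi(r,s,p)=(1,2)\circ\mathrm{Rev}(3,r)$ when $p\mid r$, and $\pi(r,s,p)=\mathrm{Rev}(3,r)$ when $p\nmid r$. 3. If $s_{\bmod p^m}=3$ and $r\ge 4$, then $\pi(r,s,p)=\pi(3,r,p)\circ\mathrm{Rev}(4,r)$, where $\pi(3,r,p)$ is also well defined, independently of the field of characteristic $p$. -/

import Mathlib

open scoped Kronecker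

universe u

/-- The unipotent Jordan block `J_n = I_n + N_n`, with `N_n` having entries `1` in the
positions `(i, i + 1)` and `0` elsewhere. -/
def unipotentJordanBlock (F : Type*) [CommRing F] (n : ℕ) : Matrix (Fin n) (Fin n) F :=
  1 + Matrix.of fun i j : Fin n => if (i : ℕ) + 1 = (j : ℕ) then 1 else 0

/-- The square matrix `A` is conjugate to the block diagonal matrix with
blocks `J_{μ k}`, where `k` runs over `κ`. -/
def HasUnipotentJordanForm {F : Type*} [CommRing F] {ι κ : Type*} [Fintype ι] [DecidableEq ι]
    [DecidableEq κ] (A : Matrix ι ι F) (μ : κ → ℕ) : Prop :=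
  ∃ (e : (Σ k, Fin (μ k)) ≃ ι) (P : GL ι F),
    (P : Matrix ι ι F)⁻¹ * A * (P : Matrix ι ι F) =
      Matrix.reindex e e (Matrix.blockDiagonal' fun k => unipotentJordanBlock F (μ k))

/-- `lam 0 ≥ lam 1 ≥ ⋯ ≥ lam (r - 1) > 0` are the block sizes in the Jordan canonical form of
`J_r ⊗ J_s` over `F`; so `lam k` is the part `λ_{k+1}` of the partition `λ` of `r * s`. -/
structure IsJordanPartition (F : Type*) [CommRing F] (r s : ℕ) (lam : Fin r → ℕ) : Prop where
  antitone : Antitone lam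
  pos : ∀ k, 0 < lam k
  jordanForm :
    HasUnipotentJordanForm (unipotentJordanBlock F r ⊗ₖ unipotentJordanBlock F s) lam

/-- `σ` is the Norman permutation of `{1, …, r}` attached to the Jordan form of `J_r ⊗ J_s` over
`F`, i.e. `σ n = (r + 1 - n) + s - λ_n` for `1 ≤ n ≤ r`. A permutation of `{1, …, r}` is viewed as a
permutation of `ℕ` that fixes every point outside `{1, …, r}`, so that the symmetric group on
`{1, …, r'}` is contained in that on `{1, …, r}` for `r' ≤ r`. -/
structure IsNormanPermutation (F : Type*) [CommRing F] (r s : ℕ) (σ : Equiv.Perm ℕ) : Prop where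
  fixes : ∀ n, n ∉ Set.Icc 1 r → σ n = n
  formula : ∃ lam : Fin r → ℕ, IsJordanPartition F r s lam ∧
    ∀ k : Fin r, (σ (k + 1) : ℤ) = ((r : ℤ) + 1 - ((k : ℤ) + 1)) + s - lam k

open Classical in
/-- The Norman permutation `π(r, s, p)`, taken over the prime field of order `p` (and equal to the
identity by convention in case no Norman permutation exists). -/
noncomputable def normanPermutation (r s p : ℕ) : Equiv.Perm ℕ :=
  if h : ∃ σ, IsNormanPermutation (ZMod p) r s σ then h.choose else 1

/-- `π(r, s, p)` is well defined and does not depend on the field of characteristic `p`: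
it is the one and only Norman permutation attached to `J_r ⊗ J_s` over each such field. -/
def NormanPermutationWellDefined (r s p : ℕ) : Prop :=
  ∀ (F : Type u) [Field F] [CharP F p] (σ : Equiv.Perm ℕ),
    IsNormanPermutation F r s σ ↔ σ = normanPermutation r s p

theorem reversal_involutive (i j : ℕ) :
    Function.Involutive fun n : ℕ => if i ≤ n ∧ n ≤ j then j + i - n else n := by
  intro n
  dsimp only
  split_ifs <;> omega

/-- The reversal permutation `Rev(i, j)`: it sends `n` to `j + i - n` for `i ≤ n ≤ j` and fixes all
other points. -/
def reversalPerm (i j : ℕ) : Equiv.Perm ℕ :=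
  (reversal_involutive i j).toPerm

/-! ### Ranks of powers determine the partition. -/

section Uniqueness

/-! On `F[x, y]/(x ^ r, y ^ s)` the matrix `J_r ⊗ J_s` is multiplication by `(1 + x)(1 + y) = 1 +
u`, where `u = x + y + xy = (1 + y) z` and `z = x + y/(1 + y)`. As `1 + y` is a unit, block sizes
are chain lengths of `z`. Write `y'` for `y/(1 + y)`; then `y' ^ s = 0`.

Let `s = a + t` with `t = s % p ^ m`. Since `x ^ (p ^ m) = 0`, Frobenius gives `z ^ a = y' ^ a`. So
a chain of length `μ` for `x + y` modulo `(x ^ r, y ^ t)` lifts to a relation `z ^ (a + μ) w = 0`,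
while the elements `x ^ j y' ^ t` with `j < r - t` are killed by `z ^ a`. The blocks are `a + μ_1,
…, a + μ_t` and `r - t` copies of `a`. The copies of `a` give `Rev(t + 1, r)`; in the other blocks
`a` cancels and `π(t, r, p)` remains (`HasLiftedChains.isNormanPermutation`).

For `t ≤ 3` the chains are explicit: their generators are forms in `x, y` whose shape depends only
on which of `r`, `C(r, 2)`, `C(r + 1, 2)` vanish modulo `p`. -/

theorem pow_apply_chain_basis {F V κ : Type*} [Field F] [AddCommGroup V] [Module F V] {μ : κ → ℕ}
    (b : (Σ k, Fin (μ k)) → V) (f : Module.End F V)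
    (hf : ∀ k (i : Fin (μ k)), f (b ⟨k, i⟩) =
      if 0 < i.1 then b ⟨k, ⟨i.1 - 1, by omega⟩⟩ else 0) (j : ℕ) (k : κ) (i : Fin (μ k)) :
    (f ^ j) (b ⟨k, i⟩) = if j ≤ i.1 then b ⟨k, ⟨i.1 - j, by omega⟩⟩ else 0 := by
  induction j with
  | zero => simp
  | succ j ih =>
    rw [pow_succ', Module.End.mul_apply, ih]
    split_ifs with h1 h2 h2
    · rw [hf, if_pos (by simp; omega)]
      simp only [Nat.sub_sub]
    · rw [hf, if_neg (by simp; omega)]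
    · omega
    · simp

theorem finrank_range_pow_chain_basis {F V κ : Type*} [Field F] [AddCommGroup V] [Module F V]
    [Fintype κ] {μ : κ → ℕ}
    (b : Module.Basis (Σ k, Fin (μ k)) F V) (f : Module.End F V)
    (hf : ∀ k (i : Fin (μ k)), f (b ⟨k, i⟩) =
      if 0 < i.1 then b ⟨k, ⟨i.1 - 1, by omega⟩⟩ else 0) (j : ℕ) :
    Module.finrank F (LinearMap.range (f ^ j)) = ∑ k, (μ k - j) := by
  have hpow := pow_apply_chain_basis b f hf j
  let g : (Σ k, Fin (μ k - j)) → V := fun x => b ⟨x.1, ⟨x.2.1, by have := x.2.2; omega⟩⟩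
  have hg : LinearIndependent F g := by
    refine b.linearIndependent.comp
      (fun x : Σ k, Fin (μ k - j) => (⟨x.1, ⟨x.2.1, by have := x.2.2; omega⟩⟩ : Σ k, Fin (μ k))) ?_
    rintro ⟨k, i⟩ ⟨k', i'⟩ h
    simp only [Sigma.mk.injEq] at h
    obtain ⟨rfl, h⟩ := h
    simp only [heq_eq_eq, Fin.mk.injEq] at h
    simp [Fin.ext_iff, h]
  have hspan : LinearMap.range (f ^ j) = Submodule.span F (Set.range g) := by
    rw [LinearMap.range_eq_map, ← b.span_eq, Submodule.map_span]
    apply le_antisymm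
    · rw [Submodule.span_le]
      rintro _ ⟨_, ⟨⟨k, i⟩, rfl⟩, rfl⟩
      rw [hpow]
      split_ifs with h
      · exact Submodule.subset_span ⟨⟨k, ⟨i.1 - j, by have := i.2; omega⟩⟩, rfl⟩
      · exact Submodule.zero_mem _
    · refine Submodule.span_mono ?_
      rintro _ ⟨⟨k, i⟩, rfl⟩
      refine ⟨_, ⟨⟨k, ⟨i.1 + j, by have := i.2; omega⟩⟩, rfl⟩, ?_⟩
      rw [hpow, if_pos (by simp)]
      simp [g]
  rw [hspan, finrank_span_eq_card hg]
  simp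

theorem rank_pow_of_hasUnipotentJordanForm {F ι κ : Type*} [Field F] [Fintype ι] [DecidableEq ι]
    [Fintype κ] [DecidableEq κ] {A : Matrix ι ι F} {μ : κ → ℕ}
    (h : HasUnipotentJordanForm A μ) (j : ℕ) :
    ((A - 1) ^ j).rank = ∑ k, (μ k - j) := by
  obtain ⟨e, P, hP⟩ := h
  set B := Matrix.blockDiagonal' fun k => unipotentJordanBlock F (μ k) with hB
  have hdet : IsUnit (P : Matrix ι ι F).det := (Matrix.isUnit_iff_isUnit_det _).1 P.isUnit
  have hconj : (P : Matrix ι ι F)⁻¹ * (A - 1) ^ j * (P : Matrix ι ι F) =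
      Matrix.reindexAlgEquiv F F e ((B - 1) ^ j) := by
    rw [map_pow, map_sub, map_one, Matrix.coe_reindexAlgEquiv, ← hP]
    have h1 : (P : Matrix ι ι F)⁻¹ * A * (P : Matrix ι ι F) - 1 =
        (P : Matrix ι ι F)⁻¹ * (A - 1) * (P : Matrix ι ι F) := by
      rw [mul_sub, sub_mul, mul_one, Matrix.nonsing_inv_mul _ hdet]
    rw [h1]
    induction j with
    | zero => simp [Matrix.nonsing_inv_mul _ hdet]
    | succ n ih =>
      rw [pow_succ, pow_succ, ← ih]
      simp only [mul_assoc]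
      rw [Matrix.mul_nonsing_inv_cancel_left _ _ hdet]
  have hrank : ((A - 1) ^ j).rank = ((B - 1) ^ j).rank := by
    rw [← Matrix.rank_reindex e e ((B - 1) ^ j), ← Matrix.coe_reindexAlgEquiv F F, ← hconj,
      Matrix.rank_mul_eq_left_of_isUnit_det _ _ hdet,
      Matrix.rank_mul_eq_right_of_isUnit_det _ _ (Matrix.isUnit_nonsing_inv_det _ hdet)]
  rw [hrank, Matrix.rank, ← Matrix.toLin'_apply', Matrix.toLin'_pow]
  refine finrank_range_pow_chain_basis (Pi.basisFun F _) _ ?_ j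
  intro k i
  rw [Matrix.toLin'_apply, Pi.basisFun_apply, Matrix.mulVec_single_one]
  ext ⟨k', i'⟩
  rw [Matrix.col_apply, Matrix.sub_apply, hB, Matrix.blockDiagonal'_apply]
  by_cases hk : k' = k
  · subst hk
    simp only [dif_pos, cast_eq, unipotentJordanBlock, Matrix.add_apply, Matrix.of_apply,
      Matrix.one_apply, Sigma.mk.injEq, heq_eq_eq, true_and, add_sub_cancel_left]
    split_ifs with h1 h2 h2
    · have : i' = ⟨i.1 - 1, by omega⟩ := Fin.ext (by simp; omega)
      simp [this]
    · omega
    · rw [Pi.basisFun_apply, Pi.single_eq_of_ne]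
      intro h
      simp [Fin.ext_iff] at h
      omega
    · rfl
  · rw [dif_neg hk, Matrix.one_apply_ne (by simp [hk])]
    split_ifs with h
    · simp [hk]
    · simp

/-- The drop of the sum from `j` to `j + 1` counts the parts exceeding `j`. For sorted families
those parts occupy initial segments, which are nested, so equal counts give equal segments. -/
theorem antitone_eq_of_sum_sub_eq {r : ℕ} {f g : Fin r → ℕ} (hf : Antitone f) (hg : Antitone g)
    (h : ∀ j, ∑ k, (f k - j) = ∑ k, (g k - j)) : f = g := by
  have key : ∀ (f : Fin r → ℕ) (j : ℕ), ∑ k, (f k - j) =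
      ∑ k, (f k - (j + 1)) + (Finset.univ.filter fun k => j < f k).card := by
    intro f j
    rw [Finset.card_filter, ← Finset.sum_add_distrib]
    refine Finset.sum_congr rfl fun k _ => ?_
    split_ifs <;> omega
  have hset : ∀ j, (Finset.univ.filter fun k => j < f k) =
      Finset.univ.filter fun k => j < g k := by
    intro j
    have hcard : (Finset.univ.filter fun k => j < f k).card =
        (Finset.univ.filter fun k => j < g k).card := by
      have h1 := key f j
      have h2 := key g j
      have := h j
      have := h (j + 1)
      omega
    have low : ∀ f : Fin r → ℕ, Antitone f → IsLowerSet {k | j < f k} :=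
      fun f hf a b hba ha => lt_of_lt_of_le ha (hf hba)
    rcases (low f hf).total (low g hg) with hs | hs
    · exact Finset.eq_of_subset_of_card_le (fun k hk => by simpa using hs (by simpa using hk))
        hcard.ge
    · exact (Finset.eq_of_subset_of_card_le (fun k hk => by simpa using hs (by simpa using hk))
        hcard.le).symm
  funext k
  have hk : ∀ j, j < f k ↔ j < g k := fun j => by simpa using Finset.ext_iff.1 (hset j) k
  have h1 := hk (f k)
  have h2 := hk (g k)
  omega

theorem IsJordanPartition.eq {F : Type*} [Field F] {r s : ℕ} {f g : Fin r → ℕ}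
    (hf : IsJordanPartition F r s f) (hg : IsJordanPartition F r s g) : f = g :=
  antitone_eq_of_sum_sub_eq hf.antitone hg.antitone fun j => by
    rw [← rank_pow_of_hasUnipotentJordanForm hf.jordanForm,
      rank_pow_of_hasUnipotentJordanForm hg.jordanForm]

theorem IsNormanPermutation.eq {F : Type*} [Field F] {r s : ℕ} {σ τ : Equiv.Perm ℕ}
    (hσ : IsNormanPermutation F r s σ) (hτ : IsNormanPermutation F r s τ) : σ = τ := by
  obtain ⟨f, hf, hσf⟩ := hσ.formula
  obtain ⟨g, hg, hτg⟩ := hτ.formula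
  obtain rfl := hf.eq hg
  ext n
  by_cases hn : n ∈ Set.Icc 1 r
  · have h1 := hσf ⟨n - 1, by have := hn.1; have := hn.2; omega⟩
    have h2 := hτg ⟨n - 1, by have := hn.1; have := hn.2; omega⟩
    simp only [Nat.sub_add_cancel hn.1] at h1 h2
    omega
  · rw [hσ.fixes n hn, hτ.fixes n hn]

theorem normanPermutation_eq {r s p : ℕ} [Fact p.Prime] {σ : Equiv.Perm ℕ}
    (h : IsNormanPermutation (ZMod p) r s σ) : normanPermutation r s p = σ := by
  have hex : ∃ σ, IsNormanPermutation (ZMod p) r s σ := ⟨σ, h⟩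
  rw [normanPermutation, dif_pos hex]
  exact hex.choose_spec.eq h

theorem normanPermutationWellDefined_of {r s p : ℕ} [Fact p.Prime] {σ : Equiv.Perm ℕ}
    (h : IsNormanPermutation (ZMod p) r s σ)
    (hF : ∀ (F : Type u) [Field F] [CharP F p], IsNormanPermutation F r s σ) :
    NormanPermutationWellDefined.{u} r s p := by
  intro F _ _ τ
  rw [normanPermutation_eq h]
  exact ⟨fun hτ => hτ.eq (hF F), fun hτ => hτ ▸ hF F⟩

end Uniqueness

/-! ### Jordan bases from chains in truncated polynomial rings. -/

section Existence

theorem hasUnipotentJordanForm_toMatrix {F ι κ V : Type*} [Field F] [Fintype ι] [DecidableEq ι]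
    [Fintype κ] [DecidableEq κ] [AddCommGroup V] [Module F V] {μ : κ → ℕ}
    (c : Module.Basis ι F V) (b : Module.Basis (Σ k, Fin (μ k)) F V) (f : Module.End F V)
    (hf : ∀ k (i : Fin (μ k)), f (b ⟨k, i⟩) = b ⟨k, i⟩ +
      if 0 < i.1 then b ⟨k, ⟨i.1 - 1, by omega⟩⟩ else 0) :
    HasUnipotentJordanForm (LinearMap.toMatrix c c f) μ := by
  let e := b.indexEquiv c
  let b' := b.reindex e
  have hPQ : c.toMatrix b' * b'.toMatrix c = 1 := c.toMatrix_mul_toMatrix_flip b'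
  have hQP : b'.toMatrix c * c.toMatrix b' = 1 := b'.toMatrix_mul_toMatrix_flip c
  refine ⟨e, ⟨c.toMatrix b', b'.toMatrix c, hPQ, hQP⟩, ?_⟩
  change (c.toMatrix b')⁻¹ * _ * c.toMatrix b' = _
  rw [Matrix.inv_eq_right_inv hPQ, basis_toMatrix_mul_linearMap_toMatrix_mul_basis_toMatrix]
  ext x y
  obtain ⟨⟨k', i'⟩, rfl⟩ := e.surjective x
  obtain ⟨⟨k, i⟩, rfl⟩ := e.surjective y
  rw [LinearMap.toMatrix_apply, Matrix.reindex_apply, Matrix.submatrix_apply,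
    e.symm_apply_apply, e.symm_apply_apply, Module.Basis.repr_reindex_apply, e.symm_apply_apply]
  simp only [b', Module.Basis.reindex_apply, Equiv.symm_apply_apply]
  rw [hf, map_add, Finsupp.add_apply, Module.Basis.repr_self, Matrix.blockDiagonal'_apply]
  by_cases hk : k' = k
  · subst hk
    simp only [dif_pos, cast_eq, unipotentJordanBlock, Matrix.add_apply, Matrix.of_apply]
    congr 1
    · rw [Finsupp.single_apply, Matrix.one_apply]
      simp [eq_comm]
    · split_ifs with h1 h2 h2
      · rw [Module.Basis.repr_self, Finsupp.single_apply, if_pos]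
        simp [Fin.ext_iff]
        omega
      · rw [Module.Basis.repr_self, Finsupp.single_apply, if_neg]
        simp [Fin.ext_iff]
        omega
      · omega
      · simp
  · rw [dif_neg hk, Finsupp.single_apply, if_neg (by simp [Ne.symm hk]), zero_add]
    split_ifs
    · rw [Module.Basis.repr_self, Finsupp.single_apply, if_neg (by simp [Ne.symm hk])]
    · simp

/-- Nakayama for a nilpotent element: `A = W + uA` iterates to `A = W + u ^ n A`, so the chains
span, and the dimension count makes them a basis. -/
theorem exists_chain_basis {F A κ : Type*} [Field F] [CommRing A] [Algebra F A]
    [Fintype κ] {μ : κ → ℕ} {u : A} (hu : IsNilpotent u) (v : κ → A)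
    (hv : ∀ k, u ^ μ k * v k = 0) (hdim : ∑ k, μ k = Module.finrank F A)
    (hspan : Submodule.span F (Set.range v) ⊔ (Ideal.span {u}).restrictScalars F = ⊤) :
    ∃ b : Module.Basis (Σ k, Fin (μ k)) F A, ∀ k (i : Fin (μ k)),
      u * b ⟨k, i⟩ = if 0 < i.1 then b ⟨k, ⟨i.1 - 1, by omega⟩⟩ else 0 := by
  let g : (Σ k, Fin (μ k)) → A := fun x => u ^ (μ x.1 - 1 - x.2.1) * v x.1
  let W := Submodule.span F (Set.range g)
  have hmem : ∀ n k, u ^ n * v k ∈ W := by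
    intro n k
    rcases lt_or_ge n (μ k) with h | h
    · refine Submodule.subset_span ⟨⟨k, ⟨μ k - 1 - n, by omega⟩⟩, ?_⟩
      simp only [g]
      congr 2
      omega
    · obtain ⟨d, rfl⟩ := Nat.exists_eq_add_of_le h
      rw [pow_add, mul_right_comm, hv, zero_mul]
      exact W.zero_mem
  have hmul : ∀ n, ∀ a ∈ Submodule.span F (Set.range v), u ^ n * a ∈ W := by
    intro n a ha
    induction ha using Submodule.span_induction with
    | mem x hx => obtain ⟨k, rfl⟩ := hx; exact hmem n k
    | zero => rw [mul_zero]; exact W.zero_mem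
    | add x y _ _ hx hy => rw [mul_add]; exact W.add_mem hx hy
    | smul c x _ hx => rw [mul_smul_comm]; exact W.smul_mem c hx
  have hstep : ∀ n a, ∃ w ∈ W, ∃ d, a = w + u ^ n * d := by
    intro n
    induction n with
    | zero => exact fun a => ⟨0, W.zero_mem, a, by simp⟩
    | succ n ih =>
      intro a
      obtain ⟨w, hw, d, rfl⟩ := ih a
      have hd : d ∈ Submodule.span F (Set.range v) ⊔ (Ideal.span {u}).restrictScalars F :=
        hspan ▸ Submodule.mem_top
      obtain ⟨a, ha, q, hq, rfl⟩ := Submodule.mem_sup.1 hd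
      obtain ⟨d, rfl⟩ := Ideal.mem_span_singleton.1 (Submodule.restrictScalars_mem F _ _ |>.1 hq)
      exact ⟨w + u ^ n * a, W.add_mem hw (hmul n a ha), d, by ring⟩
  have htop : ⊤ ≤ Submodule.span F (Set.range g) := by
    intro a _
    obtain ⟨n, hn⟩ := hu
    obtain ⟨w, hw, d, rfl⟩ := hstep n a
    rwa [hn, zero_mul, add_zero]
  refine ⟨basisOfTopLeSpanOfCardEqFinrank g htop (by simpa using hdim), fun k i => ?_⟩
  simp only [coe_basisOfTopLeSpanOfCardEqFinrank, g]
  have hi := i.2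
  split_ifs with h
  · rw [← mul_assoc, ← pow_succ']
    congr 2
    omega
  · rw [← mul_assoc, ← pow_succ', show μ k - 1 - i.1 + 1 = μ k by omega, hv]

/-- Modulo `x + y + x * y`, the monomial `x ^ i * y ^ (j + 1)` equals `-x ^ (i + 1) * y ^ j - x ^ (i
+ 1) * y ^ (j + 1)`. The second term keeps the exponent of `y`, hence an inner descending induction
on `i`, run through `d`, that stops at `x ^ r = 0`. -/
theorem sup_span_eq_top {F A : Type*} [Field F] [CommRing A] [Algebra F A] {x y : A} {r : ℕ}
    (hxy : Submodule.span F (Set.range fun n : ℕ × ℕ => x ^ n.1 * y ^ n.2) = ⊤)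
    (hx : x ^ r = 0) (W : Submodule F A)
    (hW : (Ideal.span {x + y + x * y}).restrictScalars F ≤ W) (hxW : ∀ i < r, x ^ i ∈ W) :
    W = ⊤ := by
  have key : ∀ j d i, r ≤ i + d → x ^ i * y ^ j ∈ W := by
    intro j
    induction j with
    | zero =>
      intro d i _
      rw [pow_zero, mul_one]
      rcases lt_or_ge i r with h | h
      · exact hxW i h
      · rw [pow_eq_zero_of_le h hx]
        exact W.zero_mem
    | succ j ihj =>
      intro d
      induction d with
      | zero =>
        intro i h
        rw [pow_eq_zero_of_le (by omega) hx, zero_mul]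
        exact W.zero_mem
      | succ d ihd =>
        intro i h
        have h1 := ihd (i + 1) (by omega)
        have h2 := ihj r (i + 1) (by omega)
        have h3 : (x + y + x * y) * (x ^ i * y ^ j) ∈ W :=
          hW (Ideal.mul_mem_right _ _ (Ideal.mem_span_singleton_self _))
        convert W.sub_mem (W.sub_mem h3 h1) h2 using 1
        ring
  rw [eq_top_iff, ← hxy, Submodule.span_le]
  rintro _ ⟨n, rfl⟩
  exact key n.2 r n.1 (by omega)

theorem exists_unipotentJordanBlock_model (F : Type u) [Field F] (n : ℕ) :
    ∃ (A : Type u) (_ : CommRing A) (_ : Algebra F A) (b : Module.Basis (Fin n) F A) (x : A),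
      x ^ n = 0 ∧ (∀ i, b i = x ^ (n - 1 - i)) ∧
        LinearMap.toMatrix b b (LinearMap.mulLeft F (1 + x)) = unipotentJordanBlock F n := by
  have hm : (Polynomial.X ^ n : Polynomial F).Monic := Polynomial.monic_X_pow n
  let B := AdjoinRoot.powerBasis' hm
  have hdim : B.dim = n := by simp [B]
  have hgen : B.gen = AdjoinRoot.root (Polynomial.X ^ n : Polynomial F) := by simp [B]
  set x := AdjoinRoot.root (Polynomial.X ^ n : Polynomial F) with hxdef
  have hx : x ^ n = 0 := by
    have := AdjoinRoot.eval₂_root (Polynomial.X ^ n : Polynomial F)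
    simpa using this
  -- Reversing the powers puts the ones above the diagonal.
  let b := B.basis.reindex ((finCongr hdim).trans Fin.revPerm)
  have hb : ∀ i, b i = x ^ (n - 1 - i) := by
    intro i
    simp only [b, Module.Basis.reindex_apply, PowerBasis.basis_eq_pow, hgen]
    congr 1
    simp [Fin.val_rev]
    omega
  refine ⟨_, inferInstance, inferInstance, b, x, hx, hb, ?_⟩
  ext i j
  have hmul : (1 + x) * b j = b j + if h : 0 < j.1 then b ⟨j.1 - 1, by omega⟩ else 0 := by
    rw [add_mul, one_mul]
    congr 1
    have := j.2
    split_ifs with h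
    · rw [hb, hb, ← pow_succ']
      congr 1
      simp only
      omega
    · rw [hb, ← pow_succ', show n - 1 - j.1 + 1 = n by omega, hx]
  rw [LinearMap.toMatrix_apply, LinearMap.mulLeft_apply, hmul, map_add, Finsupp.add_apply,
    unipotentJordanBlock, Matrix.add_apply, Matrix.of_apply]
  congr 1
  · rw [Module.Basis.repr_self, Finsupp.single_apply, Matrix.one_apply]
    simp [eq_comm]
  · split_ifs with h1 h2 h2
    · rw [Module.Basis.repr_self, Finsupp.single_apply, if_pos]
      simp [Fin.ext_iff]
      omega
    · rw [Module.Basis.repr_self, Finsupp.single_apply, if_neg]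
      simp [Fin.ext_iff]
      omega
    · omega
    · simp

open TensorProduct in
theorem exists_kronecker_model (F : Type u) [Field F] (r s : ℕ) :
    ∃ (A : Type u) (_ : CommRing A) (_ : Algebra F A)
      (b : Module.Basis (Fin r × Fin s) F A) (x y : A), x ^ r = 0 ∧ y ^ s = 0 ∧
        Submodule.span F (Set.range fun n : ℕ × ℕ => x ^ n.1 * y ^ n.2) = ⊤ ∧
        LinearMap.toMatrix b b (LinearMap.mulLeft F (1 + (x + y + x * y))) =
          unipotentJordanBlock F r ⊗ₖ unipotentJordanBlock F s := by
  obtain ⟨A, _, _, b, x, hx, hb, hA⟩ := exists_unipotentJordanBlock_model F r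
  obtain ⟨B, _, _, c, y, hy, hc, hB⟩ := exists_unipotentJordanBlock_model F s
  refine ⟨A ⊗[F] B, inferInstance, inferInstance, b.tensorProduct c, x ⊗ₜ 1, 1 ⊗ₜ y, ?_, ?_, ?_,
    ?_⟩
  · rw [Algebra.TensorProduct.tmul_pow, hx, TensorProduct.zero_tmul]
  · rw [Algebra.TensorProduct.tmul_pow, hy, TensorProduct.tmul_zero]
  · rw [eq_top_iff, ← (b.tensorProduct c).span_eq]
    refine Submodule.span_mono ?_
    rintro _ ⟨⟨i, j⟩, rfl⟩
    refine ⟨(r - 1 - i, s - 1 - j), ?_⟩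
    simp [Module.Basis.tensorProduct_apply, hb, hc, Algebra.TensorProduct.tmul_pow]
  · rw [← hA, ← hB, ← TensorProduct.toMatrix_map]
    congr 1
    ext p q
    simp [TensorProduct.add_tmul, TensorProduct.tmul_add, add_mul]
    abel

/-- Replacing `u = x + y + x * y` by its unit multiple `z` changes neither the ideal nor the
exponents that annihilate an element, and turns the problem into one about a sum of two nilpotents.
-/
theorem hasUnipotentJordanForm_of_chains {F A κ : Type*} [Field F] [CommRing A] [Algebra F A]
    [Fintype κ] [DecidableEq κ] {r s : ℕ} (b : Module.Basis (Fin r × Fin s) F A) {x y z ε : A}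
    (hx : x ^ r = 0) (hy : y ^ s = 0)
    (hxy : Submodule.span F (Set.range fun n : ℕ × ℕ => x ^ n.1 * y ^ n.2) = ⊤)
    (hε : ε * (1 + y) = 1) (hz : z = x + y * ε) {μ : κ → ℕ} (hμ : ∑ k, μ k = r * s) (v : κ → A)
    (hv : ∀ k, z ^ μ k * v k = 0)
    (hspan : ∀ i < r, x ^ i ∈
      Submodule.span F (Set.range v) ⊔ (Ideal.span {z}).restrictScalars F) :
    HasUnipotentJordanForm
      (LinearMap.toMatrix b b (LinearMap.mulLeft F (1 + (x + y + x * y)))) μ := by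
  set u := x + y + x * y with hu
  have huz : u = (1 + y) * z := by
    rw [hz, hu]
    linear_combination (-y) * hε
  have hzu : z = ε * u := by
    rw [huz, ← mul_assoc, hε, one_mul]
  have hideal : Ideal.span {z} = Ideal.span {u} :=
    le_antisymm (Ideal.span_singleton_le_span_singleton.2 ⟨ε, hzu.trans (mul_comm _ _)⟩)
      (Ideal.span_singleton_le_span_singleton.2 ⟨1 + y, huz.trans (mul_comm _ _)⟩)
  rw [hideal] at hspan
  have hnil : IsNilpotent u := by
    have h1 : IsNilpotent x := ⟨r, hx⟩
    have h2 : IsNilpotent y := ⟨s, hy⟩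
    exact (Commute.all _ _).isNilpotent_add ((Commute.all _ _).isNilpotent_add h1 h2)
      ((Commute.all _ _).isNilpotent_mul_right h1)
  obtain ⟨b', hb'⟩ := exists_chain_basis (F := F) hnil v
    (fun k => by rw [huz, mul_pow, mul_assoc, hv, mul_zero])
    (by rw [hμ, Module.finrank_eq_card_basis b]; simp)
    (sup_span_eq_top hxy hx _ le_sup_right hspan)
  refine hasUnipotentJordanForm_toMatrix b b' _ fun k i => ?_
  rw [LinearMap.mulLeft_apply, add_mul, one_mul, hb']

end Existence

/-! ### Lifting chains from exponent `t` to exponent `a + t`. -/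

section ChainData

/-- Lifted chain generators for multiplication by `x + y` on `F[x, y] / (x ^ r, y ^ t)`: the `k`-th
generator agrees with a multiple of `x ^ k` modulo `x + y`, and its chain has length `μ k`. -/
def HasLiftedChains (F : Type u) [Field F] (r t : ℕ) (μ : Fin t → ℕ) : Prop :=
  ∀ (A : Type u) [CommRing A] [Algebra F A] (x y c : A), x ^ r = 0 → c * y ^ t = 0 →
    ∃ w : Fin t → A, ∀ k, c * ((x + y) ^ μ k * w k) = 0 ∧
      ∃ (α : F) (d : A), x ^ (k : ℕ) = α • w k + (x + y) * d

theorem HasLiftedChains.hasUnipotentJordanForm_base {F : Type u} [Field F] {r t : ℕ}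
    {μ : Fin t → ℕ} (h : HasLiftedChains F r t μ) (hμ : ∑ k, μ k = t * r) :
    HasUnipotentJordanForm (unipotentJordanBlock F t ⊗ₖ unipotentJordanBlock F r) μ := by
  obtain ⟨A, _, _, b, x, y, hx, hy, hxy, hb⟩ := exists_kronecker_model F t r
  obtain ⟨ε, hε⟩ := (IsNilpotent.isUnit_one_add ⟨r, hy⟩).exists_left_inv
  -- Here `c = 1`, and the two variables exchange roles because the factors are in the order `t`,
  -- `r`.
  obtain ⟨w, hw⟩ := h A (y * ε) x 1 (by rw [mul_pow, hy, zero_mul]) (by rw [hx, mul_zero])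
  rw [← hb]
  refine hasUnipotentJordanForm_of_chains b hx hy hxy hε rfl hμ w (fun k => ?_) fun i hi => ?_
  · rw [add_comm x, ← (hw k).1, one_mul]
  · obtain ⟨α, d, hd⟩ := (hw ⟨i, hi⟩).2
    -- Modulo `x + y * ε`, `x ^ i` is `(-1) ^ i` times the `i`-th power of `y * ε`, which is the
    -- power that `hw` controls.
    obtain ⟨e, he⟩ := sub_dvd_pow_sub_pow x (-(y * ε)) i
    refine Submodule.mem_sup.2 ⟨((-1) ^ i * α) • w ⟨i, hi⟩,
      Submodule.smul_mem _ _ (Submodule.subset_span ⟨_, rfl⟩), (x + y * ε) * (e + (-1) ^ i * d),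
      Ideal.mul_mem_right _ _ (Ideal.mem_span_singleton_self _), ?_⟩
    simp only [neg_pow (y * ε), sub_neg_eq_add] at he hd
    have hα : ((-1) ^ i * α) • w ⟨i, hi⟩ = (-1) ^ i * (α • w ⟨i, hi⟩) := by
      rw [mul_smul, Algebra.smul_def ((-1 : F) ^ i)]
      simp
    rw [hα]
    linear_combination (-1) * he - (-1) ^ i * hd

theorem HasLiftedChains.hasUnipotentJordanForm {F : Type u} [Field F] {p : ℕ} [Fact p.Prime]
    [CharP F p] {r t a m : ℕ} {μ : Fin t → ℕ} (h : HasLiftedChains F r t μ) (htr : t ≤ r)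
    (hr : r ≤ p ^ m) (ha : p ^ m ∣ a) (hμ : ∑ k, μ k = t * r) :
    HasUnipotentJordanForm (unipotentJordanBlock F r ⊗ₖ unipotentJordanBlock F (a + t))
      fun k : Fin r => a + if hk : k.1 < t then μ ⟨k, hk⟩ else 0 := by
  obtain ⟨A, _, _, b, x, y, hx, hy, hxy, hb⟩ := exists_kronecker_model F r (a + t)
  obtain ⟨ε, hε⟩ := (IsNilpotent.isUnit_one_add ⟨_, hy⟩).exists_left_inv
  have hy' : (y * ε) ^ (a + t) = 0 := by rw [mul_pow, hy, zero_mul]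
  -- The multiplier `c = (y * ε) ^ a` stands for the factor `(x + y * ε) ^ a` of the longer power.
  obtain ⟨w, hw⟩ := h A x (y * ε) ((y * ε) ^ a) hx (by rw [← pow_add, hy'])
  have hza : (x + y * ε) ^ a = (y * ε) ^ a := by
    rcases subsingleton_or_nontrivial A with hA | hA
    · exact Subsingleton.elim _ _
    · have : CharP A p := charP_of_injective_algebraMap (algebraMap F A).injective p
      obtain ⟨q, rfl⟩ := ha
      rw [pow_mul, pow_mul, add_pow_char_pow, pow_eq_zero_of_le hr hx, zero_add]
  have hsum : ∑ k : Fin r, (if hk : k.1 < t then μ ⟨k, hk⟩ else 0) = ∑ k, μ k := by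
    obtain ⟨d, rfl⟩ := Nat.exists_eq_add_of_le htr
    rw [Fin.sum_univ_add]
    simp
  rw [← hb]
  refine hasUnipotentJordanForm_of_chains b hx hy hxy hε rfl ?_
    (fun k => if hk : k.1 < t then w ⟨k, hk⟩ else x ^ (k.1 - t) * (y * ε) ^ t)
    (fun k => ?_) fun i hi => ?_
  · rw [Finset.sum_add_distrib, hsum, hμ]
    simp
    ring
  · split_ifs with hk
    · rw [pow_add, mul_assoc, hza]
      exact (hw _).1
    · rw [add_zero, hza, mul_left_comm, ← pow_add, hy', mul_zero]
  · have hmem : (fun k : Fin r => if hk : k.1 < t then w ⟨k, hk⟩ else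
        x ^ (k.1 - t) * (y * ε) ^ t) ⟨i, hi⟩ ∈ Submodule.span F (Set.range fun k : Fin r =>
          if hk : k.1 < t then w ⟨k, hk⟩ else x ^ (k.1 - t) * (y * ε) ^ t) :=
      Submodule.subset_span ⟨_, rfl⟩
    by_cases hit : i < t
    · simp only [dif_pos hit] at hmem
      obtain ⟨α, d, hd⟩ := (hw ⟨i, hit⟩).2
      exact Submodule.mem_sup.2 ⟨_, Submodule.smul_mem _ α hmem, (x + y * ε) * d,
        Ideal.mul_mem_right _ _ (Ideal.mem_span_singleton_self _), hd.symm⟩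
    · simp only [dif_neg hit] at hmem
      -- Modulo `x + y * ε`, `x ^ t` becomes `(-1) ^ t * (y * ε) ^ t`, so `x ^ i` is up to sign the
      -- extra generator of index `i`.
      obtain ⟨e, he⟩ := sub_dvd_pow_sub_pow x (-(y * ε)) t
      refine Submodule.mem_sup.2 ⟨_, Submodule.smul_mem _ ((-1) ^ t) hmem,
        (x + y * ε) * (x ^ (i - t) * e),
        Ideal.mul_mem_right _ _ (Ideal.mem_span_singleton_self _), ?_⟩
      obtain ⟨j, rfl⟩ := Nat.exists_eq_add_of_le (not_lt.1 hit)
      rw [Algebra.smul_def]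
      simp only [neg_pow (y * ε), sub_neg_eq_add, map_pow, map_neg, map_one,
        Nat.add_sub_cancel_left] at he ⊢
      rw [pow_add]
      linear_combination (-x ^ j) * he

theorem HasLiftedChains.isNormanPermutation_base {F : Type u} [Field F] {r t : ℕ}
    {μ : Fin t → ℕ} (h : HasLiftedChains F r t μ) (hμ : ∑ k, μ k = t * r) (hanti : Antitone μ)
    (hpos : ∀ k, 0 < μ k) {τ : Equiv.Perm ℕ} (hfix : ∀ n, n ∉ Set.Icc 1 t → τ n = n)
    (hτ : ∀ k : Fin t, τ (k + 1) + μ k + k = t + r) : IsNormanPermutation F t r τ := by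
  refine ⟨hfix, μ, ⟨hanti, hpos, h.hasUnipotentJordanForm_base hμ⟩, fun k => ?_⟩
  have := hτ k
  omega

theorem reversalPerm_apply (i j n : ℕ) :
    reversalPerm i j n = if i ≤ n ∧ n ≤ j then j + i - n else n := rfl

/-- The hypothesis `hτ` is the Norman formula for `(t, r)`, written without subtraction. Positivity
of `a` keeps the last `r - t` blocks nonempty. -/
theorem HasLiftedChains.isNormanPermutation {F : Type u} [Field F] {p : ℕ} [Fact p.Prime]
    [CharP F p] {r t a m : ℕ} {μ : Fin t → ℕ} (h : HasLiftedChains F r t μ) (htr : t < r)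
    (hr : r ≤ p ^ m) (ha : p ^ m ∣ a) (ha0 : 0 < a) (hμ : ∑ k, μ k = t * r) (hanti : Antitone μ)
    {τ : Equiv.Perm ℕ} (hfix : ∀ n, n ∉ Set.Icc 1 t → τ n = n)
    (hτ : ∀ k : Fin t, τ (k + 1) + μ k + k = t + r) :
    IsNormanPermutation F r (a + t) (τ * reversalPerm (t + 1) r) := by
  refine ⟨fun n hn => ?_, _, ⟨?_, ?_, h.hasUnipotentJordanForm htr.le hr ha hμ⟩, fun k => ?_⟩
  · have hn' : ¬ (1 ≤ n ∧ n ≤ r) := hn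
    rw [Equiv.Perm.mul_apply, reversalPerm_apply, if_neg (by omega)]
    exact hfix n fun hn2 => hn' ⟨hn2.1, hn2.2.trans htr.le⟩
  · intro i j hij
    have hij' : i.1 ≤ j.1 := hij
    dsimp only
    split_ifs with h1 h2
    · exact Nat.add_le_add_left (hanti hij) a
    · omega
    · omega
    · omega
  · intro k
    omega
  · rw [Equiv.Perm.mul_apply, reversalPerm_apply]
    have hk := k.2
    split_ifs with h1 h2 h2
    · omega
    · rw [hfix _ (by simp only [Set.mem_Icc]; omega)]
      omega
    · have := hτ ⟨k, h2⟩
      simp only at this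
      push_cast
      omega
    · omega

end ChainData

/-! ### Explicit chains for `t ≤ 3`. -/

section ChainData

theorem cast_choose_two_mul_two (R : Type*) [CommRing R] (n : ℕ) :
    (n.choose 2 : R) * 2 = n * (n - 1) := by
  induction n with
  | zero => simp
  | succ n ih =>
    rw [Nat.choose_succ_succ' n 1, Nat.choose_one_right]
    push_cast
    linear_combination ih

theorem cast_choose_two_succ (R : Type*) [CommRing R] (n : ℕ) :
    ((n + 1).choose 2 : R) = n + n.choose 2 := by
  rw [Nat.choose_succ_succ' n 1, Nat.choose_one_right]
  push_cast
  ring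

/-- Binomial expansions modulo `y`, `y ^ 2`, `y ^ 3`; the factors `x` and `x ^ 2` avoid the
exponents `n - 1` and `n - 2`. -/
theorem exists_add_pow_eq {A : Type*} [CommRing A] (x y : A) (n : ℕ) :
    (∃ q, (x + y) ^ n = x ^ n + q * y) ∧
    (∃ q, x * (x + y) ^ n = x ^ (n + 1) + n * x ^ n * y + q * y ^ 2) ∧
    ∃ q, x ^ 2 * (x + y) ^ n =
      x ^ (n + 2) + n * x ^ (n + 1) * y + n.choose 2 * x ^ n * y ^ 2 + q * y ^ 3 := by
  induction n with
  | zero => exact ⟨⟨0, by simp⟩, ⟨0, by simp⟩, ⟨0, by simp⟩⟩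
  | succ n ih =>
    obtain ⟨⟨a, ha⟩, ⟨b, hb⟩, ⟨d, hd⟩⟩ := ih
    rw [cast_choose_two_succ]
    push_cast
    refine ⟨⟨x ^ n + a * (x + y), ?_⟩, ⟨n * x ^ n + b * (x + y), ?_⟩,
      ⟨n.choose 2 * x ^ n + d * (x + y), ?_⟩⟩
    · linear_combination (x + y) * ha
    · linear_combination (x + y) * hb
    · linear_combination (x + y) * hd

theorem exists_eq_smul_add_mul {F A : Type*} [Field F] [CommRing A] [Algebra F A] {X w z d : A}
    {δ : F} (hδ : δ ≠ 0) (h : w = algebraMap F A δ * X + z * d) :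
    ∃ (α : F) (d : A), X = α • w + z * d := by
  refine ⟨δ⁻¹, -(algebraMap F A δ⁻¹ * d), ?_⟩
  have h1 : algebraMap F A δ⁻¹ * algebraMap F A δ = 1 := by
    rw [← map_mul, inv_mul_cancel₀ hδ, map_one]
  rw [Algebra.smul_def]
  linear_combination (-X) * h1 - algebraMap F A δ⁻¹ * h

section Linear

variable {A : Type*} [CommRing A] {x y c : A} {n : ℕ}

theorem add_pow_mul_linear (hx : x ^ (n + 1) = 0) (hc : c * y ^ 2 = 0) (α β : A) :
    c * ((x + y) ^ n * (α * x + β * y)) = c * ((α * n + β) * x ^ n * y) := by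
  obtain ⟨⟨a, ha⟩, ⟨b, hb⟩, -⟩ := exists_add_pow_eq x y n
  linear_combination c * β * y * ha + c * α * hb + c * α * hx + (β * a + α * b) * hc

theorem add_pow_mul_linear_mul_add (hx : x ^ (n + 1) = 0) (hc : c * y ^ 2 = 0) (α β : A) :
    c * ((x + y) ^ (n + 1) * (α * x + β * y)) = 0 := by
  have h := add_pow_mul_linear hx hc α β
  linear_combination (x + y) * h + c * (α * n + β) * y * hx + (α * n + β) * x ^ n * hc

end Linear

section Quadratic

variable {A : Type*} [CommRing A] {x y c : A} {n : ℕ}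

/-- In degree `n + 2` only `x ^ (n + 1) * y` and `x ^ n * y ^ 2` survive. Killing a quadratic form
by `(x + y) ^ n` thus imposes two linear conditions; for `(x + y) ^ (n + 1)` only the sum of the two
coefficients must vanish. -/
theorem add_pow_mul_quadratic (hx : x ^ (n + 2) = 0) (hc : c * y ^ 3 = 0) (α β γ : A) :
    c * ((x + y) ^ n * (α * x ^ 2 + β * x * y + γ * y ^ 2)) =
      c * ((α * n + β) * x ^ (n + 1) * y + (α * n.choose 2 + β * n + γ) * x ^ n * y ^ 2) := by
  obtain ⟨⟨a, ha⟩, ⟨b, hb⟩, ⟨d, hd⟩⟩ := exists_add_pow_eq x y n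
  linear_combination c * γ * y ^ 2 * ha + c * β * y * hb + c * α * hd + c * α * hx +
    (γ * a + β * b + α * d) * hc

theorem add_pow_succ_mul_quadratic (hx : x ^ (n + 2) = 0) (hc : c * y ^ 3 = 0) (α β γ : A) :
    c * ((x + y) ^ (n + 1) * (α * x ^ 2 + β * x * y + γ * y ^ 2)) =
      c * ((α * n + β + (α * n.choose 2 + β * n + γ)) * x ^ (n + 1) * y ^ 2) := by
  have h := add_pow_mul_quadratic hx hc α β γ
  linear_combination (x + y) * h + c * (α * n + β) * y * hx +
    (α * n.choose 2 + β * n + γ) * x ^ n * hc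

theorem add_pow_add_two_mul_quadratic (hx : x ^ (n + 2) = 0) (hc : c * y ^ 3 = 0) (α β γ : A) :
    c * ((x + y) ^ (n + 2) * (α * x ^ 2 + β * x * y + γ * y ^ 2)) = 0 := by
  have h := add_pow_succ_mul_quadratic hx hc α β γ
  linear_combination (x + y) * h +
    c * (α * n + β + (α * n.choose 2 + β * n + γ)) * y ^ 2 * hx +
    (α * n + β + (α * n.choose 2 + β * n + γ)) * x ^ (n + 1) * hc

end Quadratic

theorem hasLiftedChains_zero (F : Type u) [Field F] (r : ℕ) : HasLiftedChains F r 0 ![] :=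
  fun _ _ _ _ _ _ _ _ => ⟨![], fun k => k.elim0⟩

theorem hasLiftedChains_one (F : Type u) [Field F] (r : ℕ) : HasLiftedChains F r 1 ![r] := by
  intro A _ _ x y c hx hc
  refine ⟨![1], Fin.forall_fin_one.2 ⟨?_, 1, 0, by simp⟩⟩
  obtain ⟨q, hq⟩ := (exists_add_pow_eq x y r).1
  simp only [Matrix.cons_val_zero, hq]
  linear_combination c * hx + q * hc

theorem hasLiftedChains_two_of_eq_zero {F : Type u} [Field F] {n : ℕ}
    (h0 : ((n + 1 : ℕ) : F) = 0) : HasLiftedChains F (n + 1) 2 ![n + 1, n + 1] := by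
  intro A _ _ x y c hx hc
  replace h0 : (n : A) + 1 = 0 := by simpa using congrArg (algebraMap F A) h0
  refine ⟨![1, x], Fin.forall_fin_two.2 ⟨⟨?_, 1, 0, by simp⟩, ?_, 1, 0, by simp⟩⟩
  · simp only [Matrix.cons_val_zero]
    linear_combination add_pow_mul_linear hx hc 1 1 + c * x ^ n * y * h0
  · simp only [Matrix.cons_val_one, Matrix.cons_val_zero]
    linear_combination add_pow_mul_linear_mul_add hx hc 1 0

/-- The form `x - n * y` is chosen to be killed by `(x + y) ^ n`. It is `(n + 1) * x` modulo `x +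
y`, so it is a usable generator exactly when `n + 1` is invertible. -/
theorem hasLiftedChains_two_of_ne_zero {F : Type u} [Field F] {n : ℕ}
    (h0 : ((n + 1 : ℕ) : F) ≠ 0) : HasLiftedChains F (n + 1) 2 ![n + 2, n] := by
  intro A _ _ x y c hx hc
  refine ⟨![1, x - n * y], Fin.forall_fin_two.2 ⟨⟨?_, 1, 0, by simp⟩, ?_,
    exists_eq_smul_add_mul (d := -(n : A)) h0 ?_⟩⟩
  · simp only [Matrix.cons_val_zero]
    linear_combination add_pow_mul_linear_mul_add hx hc 1 1
  · simp only [Matrix.cons_val_one, Matrix.cons_val_zero]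
    linear_combination add_pow_mul_linear hx hc 1 (-n)
  · simp
    ring

theorem forall_fin_three {P : Fin 3 → Prop} : (∀ k, P k) ↔ P 0 ∧ P 1 ∧ P 2 := by
  rw [Fin.forall_fin_succ, Fin.forall_fin_two]
  rfl

variable {F : Type u} [Field F] {n : ℕ}

/-- With `r = n + 2` the two numbers are `C(r, 2)` and `C(r + 1, 2)`, written without division so
that characteristic 2 is included. Solving the vanishing conditions gives the last two generators;
modulo `x + y` they are `C(r + 1, 2) * x` and `C(r, 2) * x ^ 2`. -/
theorem hasLiftedChains_three_regular (h1 : ((n.choose 2 + 2 * n + 1 : ℕ) : F) ≠ 0)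
    (h2 : ((n.choose 2 + 3 * n + 3 : ℕ) : F) ≠ 0) :
    HasLiftedChains F (n + 2) 3 ![n + 4, n + 2, n] := by
  intro A _ _ x y c hx hc
  have he := cast_choose_two_mul_two A n
  refine ⟨![1, (n + 2) * x - (n.choose 2 + 2 * n + 1) * y,
    x ^ 2 - n * x * y + (n ^ 2 - n.choose 2) * y ^ 2],
    forall_fin_three.2 ⟨⟨?_, 1, 0, by simp⟩, ⟨?_,
      exists_eq_smul_add_mul (d := -(n.choose 2 + 2 * n + 1)) h2 ?_⟩, ?_,
      exists_eq_smul_add_mul (d := -n * x + (n ^ 2 - n.choose 2) * (y - x)) h1 ?_⟩⟩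
  · simp
    linear_combination add_pow_add_two_mul_quadratic hx hc 1 2 1
  · simp
    linear_combination add_pow_succ_mul_quadratic hx hc (n + 2)
      (n + 2 - (n.choose 2 + 2 * n + 1)) (-(n.choose 2 + 2 * n + 1))
  · simp [map_ofNat]
    ring
  · simp
    linear_combination add_pow_mul_quadratic hx hc 1 (-n) (n ^ 2 - n.choose 2)
  · simp [map_ofNat]
    linear_combination (-x ^ 2) * he

/-- As `C(r + 1, 2)` vanishes, `(x + y) ^ (n + 3)` already kills `1`, and `x` itself serves as
second generator. -/
theorem hasLiftedChains_three_swap_one_two (h1 : ((n.choose 2 + 2 * n + 1 : ℕ) : F) ≠ 0)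
    (h2 : ((n.choose 2 + 3 * n + 3 : ℕ) : F) = 0) :
    HasLiftedChains F (n + 2) 3 ![n + 3, n + 3, n] := by
  intro A _ _ x y c hx hc
  have he := cast_choose_two_mul_two A n
  replace h2 : (n.choose 2 + 3 * n + 3 : A) = 0 := by
    simpa [map_ofNat] using congrArg (algebraMap F A) h2
  refine ⟨![1, x, x ^ 2 - n * x * y + (n ^ 2 - n.choose 2) * y ^ 2],
    forall_fin_three.2 ⟨⟨?_, 1, 0, by simp⟩, ⟨?_, 1, 0, by simp⟩, ?_,
      exists_eq_smul_add_mul (d := -n * x + (n ^ 2 - n.choose 2) * (y - x)) h1 ?_⟩⟩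
  · simp
    linear_combination add_pow_succ_mul_quadratic hx hc 1 2 1 + c * x ^ (n + 1) * y ^ 2 * h2
  · simp
    linear_combination add_pow_add_two_mul_quadratic hx hc 1 1 0
  · simp
    linear_combination add_pow_mul_quadratic hx hc 1 (-n) (n ^ 2 - n.choose 2)
  · simp [map_ofNat]
    linear_combination (-x ^ 2) * he

/-- As `C(r, 2)` vanishes, the form `x - (n + 1) * y` is killed by `(x + y) ^ (n + 1)`. The last two
generators are `r * x` and `r * x ^ 2` modulo `x + y`. -/
theorem hasLiftedChains_three_swap_two_three (h1 : ((n.choose 2 + 2 * n + 1 : ℕ) : F) = 0)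
    (h2 : ((n + 2 : ℕ) : F) ≠ 0) :
    HasLiftedChains F (n + 2) 3 ![n + 4, n + 1, n + 1] := by
  intro A _ _ x y c hx hc
  have he := cast_choose_two_mul_two A n
  replace h1 : (n.choose 2 + 2 * n + 1 : A) = 0 := by
    simpa [map_ofNat] using congrArg (algebraMap F A) h1
  refine ⟨![1, x - (n + 1) * y, x ^ 2 - (n + n.choose 2) * y ^ 2],
    forall_fin_three.2 ⟨⟨?_, 1, 0, by simp⟩,
      ⟨?_, exists_eq_smul_add_mul (d := -(n + 1)) h2 ?_⟩, ?_,
      exists_eq_smul_add_mul (d := -(n + n.choose 2) * (y - x)) h2 ?_⟩⟩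
  · simp
    linear_combination add_pow_add_two_mul_quadratic hx hc 1 2 1
  · simp
    linear_combination add_pow_mul_quadratic hx hc 1 (-n) (-(n + 1)) -
      c * x ^ n * y ^ 2 * h1 + c * x ^ n * y ^ 2 * he
  · simp [map_ofNat]
    ring
  · simp
    linear_combination add_pow_succ_mul_quadratic hx hc 1 0 (-(n + n.choose 2))
  · simp [map_ofNat]
    linear_combination (-x ^ 2) * h1

theorem hasLiftedChains_three_swap_one_three (h1 : ((n.choose 2 + 2 * n + 1 : ℕ) : F) = 0)
    (h2 : ((n + 2 : ℕ) : F) = 0) :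
    HasLiftedChains F (n + 2) 3 ![n + 2, n + 2, n + 2] := by
  intro A _ _ x y c hx hc
  replace h1 : (n.choose 2 + 2 * n + 1 : A) = 0 := by
    simpa [map_ofNat] using congrArg (algebraMap F A) h1
  replace h2 : (n + 2 : A) = 0 := by
    simpa [map_ofNat] using congrArg (algebraMap F A) h2
  refine ⟨![1, x, x ^ 2], forall_fin_three.2
    ⟨⟨?_, 1, 0, by simp⟩, ⟨?_, 1, 0, by simp⟩, ?_, 1, 0, by simp⟩⟩
  · simp
    linear_combination add_pow_mul_quadratic hx hc 1 2 1 + c * x ^ (n + 1) * y * h2 +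
      c * x ^ n * y ^ 2 * h1
  · simp
    linear_combination add_pow_succ_mul_quadratic hx hc 1 1 0 + c * x ^ (n + 1) * y ^ 2 * h1
  · simp
    linear_combination add_pow_add_two_mul_quadratic hx hc 1 0 0

end ChainData

/-! ### Assembly of the cases. -/

section Conclusion

variable {r t a m p : ℕ} [Fact p.Prime] {μ : Fin t → ℕ} {τ : Equiv.Perm ℕ}

/-- Chains over `ZMod p` are a separate hypothesis because that field, which defines
`normanPermutation`, lives in universe 0 while `F` ranges over universe `u`. -/
theorem wellDefined_and_eq_of_liftedChains
    (h0 : HasLiftedChains (ZMod p) r t μ)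
    (h : ∀ (F : Type u) [Field F] [CharP F p], HasLiftedChains F r t μ) (htr : t < r)
    (hr : r ≤ p ^ m) (ha : p ^ m ∣ a) (ha0 : 0 < a) (hμ : ∑ k, μ k = t * r) (hanti : Antitone μ)
    (hfix : ∀ n, n ∉ Set.Icc 1 t → τ n = n)
    (hτ : ∀ k : Fin t, τ (k + 1) + μ k + k = t + r) :
    NormanPermutationWellDefined.{u} r (a + t) p ∧
      normanPermutation r (a + t) p = τ * reversalPerm (t + 1) r := by
  have hz := h0.isNormanPermutation htr hr ha ha0 hμ hanti hfix hτ
  exact ⟨normanPermutationWellDefined_of hz fun F _ _ =>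
    (h F).isNormanPermutation htr hr ha ha0 hμ hanti hfix hτ, normanPermutation_eq hz⟩

theorem wellDefined_and_eq_of_liftedChains_base
    (h0 : HasLiftedChains (ZMod p) r t μ)
    (h : ∀ (F : Type u) [Field F] [CharP F p], HasLiftedChains F r t μ)
    (hμ : ∑ k, μ k = t * r) (hanti : Antitone μ) (hpos : ∀ k, 0 < μ k)
    (hfix : ∀ n, n ∉ Set.Icc 1 t → τ n = n)
    (hτ : ∀ k : Fin t, τ (k + 1) + μ k + k = t + r) :
    NormanPermutationWellDefined.{u} t r p ∧ normanPermutation t r p = τ := by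
  have hz := h0.isNormanPermutation_base hμ hanti hpos hfix hτ
  exact ⟨normanPermutationWellDefined_of hz fun F _ _ =>
    (h F).isNormanPermutation_base hμ hanti hpos hfix hτ, normanPermutation_eq hz⟩

theorem wellDefined_and_eq_three {μ : Fin 3 → ℕ}
    (h0 : HasLiftedChains (ZMod p) r 3 μ)
    (h : ∀ (F : Type u) [Field F] [CharP F p], HasLiftedChains F r 3 μ) (htr : 4 ≤ r)
    (hr : r ≤ p ^ m) (ha : p ^ m ∣ a) (ha0 : 0 < a) (hμ : ∑ k, μ k = 3 * r) (hanti : Antitone μ)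
    (hpos : 0 < μ 2) (hfix : ∀ n, n ∉ Set.Icc 1 3 → τ n = n)
    (hτ : ∀ k : Fin 3, τ (k + 1) + μ k + k = 3 + r) :
    NormanPermutationWellDefined.{u} r (a + 3) p ∧
      NormanPermutationWellDefined.{u} 3 r p ∧
      normanPermutation r (a + 3) p = normanPermutation 3 r p * reversalPerm 4 r := by
  obtain ⟨h1, h2⟩ := wellDefined_and_eq_of_liftedChains h0 h htr hr ha ha0 hμ hanti hfix hτ
  obtain ⟨h3, h4⟩ := wellDefined_and_eq_of_liftedChains_base h0 h hμ hanti
    (fun k => hpos.trans_le (hanti (Fin.le_last k))) hfix hτ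
  exact ⟨h1, h3, h4 ▸ h2⟩

theorem antitone_vec_two {a b : ℕ} (h : b ≤ a) : Antitone ![a, b] := by
  rw [Fin.antitone_iff_succ_le, Fin.forall_fin_one]
  exact h

theorem antitone_vec_three {a b c : ℕ} (h : b ≤ a) (h' : c ≤ b) : Antitone ![a, b, c] := by
  rw [Fin.antitone_iff_succ_le, Fin.forall_fin_two]
  exact ⟨h, h'⟩

theorem swap_apply_of_notMem_Icc {i j k n : ℕ} (hi : i ∈ Set.Icc 1 k) (hj : j ∈ Set.Icc 1 k)
    (hn : n ∉ Set.Icc 1 k) : Equiv.swap i j n = n :=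
  Equiv.swap_apply_of_ne_of_ne (fun h => hn (h ▸ hi)) fun h => hn (h ▸ hj)

end Conclusion

theorem mainTheorem10 (r s p m : ℕ) (hr : 1 ≤ r) (hrs : r ≤ s) (hp : p.Prime)
    (hm : r ≤ p ^ m) :
    (s % p ^ m = 0 →
      NormanPermutationWellDefined.{u} r s p ∧
        normanPermutation r s p = reversalPerm 1 r) ∧
    (2 ≤ r → s % p ^ m = 1 →
      NormanPermutationWellDefined.{u} r s p ∧
        normanPermutation r s p = reversalPerm 2 r) ∧
    (3 ≤ r → s % p ^ m = 2 → r % p = 0 →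
      NormanPermutationWellDefined.{u} r s p ∧
        normanPermutation r s p = Equiv.swap 1 2 * reversalPerm 3 r) ∧
    (3 ≤ r → s % p ^ m = 2 → r % p ≠ 0 →
      NormanPermutationWellDefined.{u} r s p ∧
        normanPermutation r s p = reversalPerm 3 r) ∧
    (4 ≤ r → s % p ^ m = 3 →
      NormanPermutationWellDefined.{u} r s p ∧
        NormanPermutationWellDefined.{u} 3 r p ∧
        normanPermutation r s p = normanPermutation 3 r p * reversalPerm 4 r) := by
  have : Fact p.Prime := ⟨hp⟩
  have hdvd : p ^ m ∣ p ^ m * (s / p ^ m) := dvd_mul_right _ _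
  have hs := Nat.div_add_mod s (p ^ m)
  -- In every case `s % p ^ m < r ≤ s`, which makes `a` positive.
  generalize p ^ m * (s / p ^ m) = a at hdvd hs
  refine ⟨fun h => ?_, fun h2 h => ?_, fun h3 h hrp => ?_, fun h3 h hrp => ?_, fun h4 h => ?_⟩
  all_goals
    rw [h] at hs
    subst hs
  · simpa using wellDefined_and_eq_of_liftedChains.{u} (τ := 1) (hasLiftedChains_zero _ r)
      (fun F _ _ => hasLiftedChains_zero F r) hr hm hdvd (by omega) (by simp)
      (fun i => i.elim0) (fun _ _ => rfl) fun k => k.elim0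
  · simpa using wellDefined_and_eq_of_liftedChains.{u} (τ := 1) (hasLiftedChains_one _ r)
      (fun F _ _ => hasLiftedChains_one F r) h2 hm hdvd (by omega) (by simp)
      (Subsingleton.antitone _) (fun _ _ => rfl) (by simp)
  · obtain ⟨n, rfl⟩ := Nat.exists_eq_add_of_le' hr
    have hn := Nat.dvd_of_mod_eq_zero hrp
    exact wellDefined_and_eq_of_liftedChains.{u} (τ := Equiv.swap 1 2)
      (hasLiftedChains_two_of_eq_zero ((CharP.cast_eq_zero_iff _ p _).2 hn))
      (fun F _ _ => hasLiftedChains_two_of_eq_zero ((CharP.cast_eq_zero_iff F p _).2 hn))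
      h3 hm hdvd (by omega) (by simp; omega) (antitone_vec_two le_rfl)
      (fun _ => swap_apply_of_notMem_Icc (by simp) (by simp))
      (by rw [Fin.forall_fin_two]; simp; omega)
  · obtain ⟨n, rfl⟩ := Nat.exists_eq_add_of_le' hr
    have hn := mt Nat.mod_eq_zero_of_dvd hrp
    simpa using wellDefined_and_eq_of_liftedChains.{u} (τ := 1)
      (hasLiftedChains_two_of_ne_zero (mt (CharP.cast_eq_zero_iff _ p _).1 hn))
      (fun F _ _ => hasLiftedChains_two_of_ne_zero (mt (CharP.cast_eq_zero_iff F p _).1 hn))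
      h3 hm hdvd (by omega) (by simp; omega) (antitone_vec_two (by omega))
      (fun _ _ => rfl) (by rw [Fin.forall_fin_two]; simp; omega)
  · obtain ⟨n, rfl⟩ := Nat.exists_eq_add_of_le' (show 2 ≤ r by omega)
    -- The tests are `p ∣ C(r, 2)`, then `p ∣ r` or `p ∣ C(r + 1, 2)`.
    by_cases h1 : p ∣ n.choose 2 + 2 * n + 1
    · by_cases h2 : p ∣ n + 2
      · exact wellDefined_and_eq_three.{u} (τ := Equiv.swap 1 3)
          (hasLiftedChains_three_swap_one_three ((CharP.cast_eq_zero_iff _ p _).2 h1)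
            ((CharP.cast_eq_zero_iff _ p _).2 h2))
          (fun F _ _ => hasLiftedChains_three_swap_one_three ((CharP.cast_eq_zero_iff F p _).2 h1)
            ((CharP.cast_eq_zero_iff F p _).2 h2))
          h4 hm hdvd (by omega) (by simp [Fin.sum_univ_three]; omega)
          (antitone_vec_three (by omega) (by omega)) (by simp)
          (fun _ => swap_apply_of_notMem_Icc (by simp) (by simp))
          (by rw [forall_fin_three]; simp [Equiv.swap_apply_def]; omega)
      · exact wellDefined_and_eq_three.{u} (τ := Equiv.swap 2 3)
          (hasLiftedChains_three_swap_two_three ((CharP.cast_eq_zero_iff _ p _).2 h1)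
            (mt (CharP.cast_eq_zero_iff _ p _).1 h2))
          (fun F _ _ => hasLiftedChains_three_swap_two_three ((CharP.cast_eq_zero_iff F p _).2 h1)
            (mt (CharP.cast_eq_zero_iff F p _).1 h2))
          h4 hm hdvd (by omega) (by simp [Fin.sum_univ_three]; omega)
          (antitone_vec_three (by omega) (by omega)) (by simp)
          (fun _ => swap_apply_of_notMem_Icc (by simp) (by simp))
          (by rw [forall_fin_three]; simp [Equiv.swap_apply_def]; omega)
    · by_cases h2 : p ∣ n.choose 2 + 3 * n + 3
      · exact wellDefined_and_eq_three.{u} (τ := Equiv.swap 1 2)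
          (hasLiftedChains_three_swap_one_two (mt (CharP.cast_eq_zero_iff _ p _).1 h1)
            ((CharP.cast_eq_zero_iff _ p _).2 h2))
          (fun F _ _ => hasLiftedChains_three_swap_one_two
            (mt (CharP.cast_eq_zero_iff F p _).1 h1) ((CharP.cast_eq_zero_iff F p _).2 h2))
          h4 hm hdvd (by omega) (by simp [Fin.sum_univ_three]; omega)
          (antitone_vec_three (by omega) (by omega)) (by simp; omega)
          (fun _ => swap_apply_of_notMem_Icc (by simp) (by simp))
          (by rw [forall_fin_three]; simp [Equiv.swap_apply_def]; omega)
      · exact wellDefined_and_eq_three.{u} (τ := 1)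
          (hasLiftedChains_three_regular (mt (CharP.cast_eq_zero_iff _ p _).1 h1)
            (mt (CharP.cast_eq_zero_iff _ p _).1 h2))
          (fun F _ _ => hasLiftedChains_three_regular (mt (CharP.cast_eq_zero_iff F p _).1 h1)
            (mt (CharP.cast_eq_zero_iff F p _).1 h2))
          h4 hm hdvd (by omega) (by simp [Fin.sum_univ_three]; omega)
          (antitone_vec_three (by omega) (by omega)) (by simp; omega)
          (fun _ _ => rfl) (by rw [forall_fin_three]; simp; omega)
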